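/- Let $\mathcal{H}$ be a separable, infinite-dimensional, complex Hilbert space, let $\mathcal{L}(\mathcal{H})$ be the algebra of all bounded linear operators on $\mathcal{H}$, and let $\mathbb{F}$ be the two-sided ideal in $\mathcal{L}(\mathcal{H})$ of finite-rank operators. Let $T'$ be an arbitrary operator in $\mathcal{L}(\mathcal{H})$ and let $\Delta_{T'}$ be the inner derivation on $\mathcal{L}(\mathcal{H})$ defined by $\Delta_{T'}(X) = T'X - XT'$ for $X \in \mathcal{L}(\mathcal{H})$. Then the range of $\Delta_{T'}$ contains no two-sided ideal of $\mathcal{L}(\mathcal{H})$ strictly larger than $\mathbb{F}$; that is, if $\mathcal{J}$ is a two-sided ideal of $\mathcal{L}(\mathcal{H})$ with $\mathbb{F} \subsetneq \mathcal{J}$, then $\mathcal{J} \not\subseteq \{T'X - XT' : X \in \mathcal{L}(\mathcal{H})\}$. -/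

import Mathlib

section

variable (H : Type*) [NormedAddCommGroup H] [InnerProductSpace ℂ H]

/-- The two-sided ideal of finite-rank operators in the algebra of bounded operators on `H`. -/
def finiteRankIdeal : TwoSidedIdeal (H →L[ℂ] H) :=
  TwoSidedIdeal.mk' {A : H →L[ℂ] H | FiniteDimensional ℂ A.toLinearMap.range}
    (by
      change FiniteDimensional ℂ (0 : H →ₗ[ℂ] H).range
      rw [LinearMap.range_zero]
      infer_instance)
    (by
      intro A B hA hB
      have hA' : FiniteDimensional ℂ A.toLinearMap.range := hA
      have hB' : FiniteDimensional ℂ B.toLinearMap.range := hB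
      exact Submodule.finiteDimensional_of_le
        (LinearMap.range_add_le A.toLinearMap B.toLinearMap))
    (by
      intro A hA
      have hA' : FiniteDimensional ℂ A.toLinearMap.range := hA
      change FiniteDimensional ℂ (-A.toLinearMap).range
      rwa [LinearMap.range_neg])
    (by
      intro A B hB
      have hB' : FiniteDimensional ℂ B.toLinearMap.range := hB
      change FiniteDimensional ℂ (A.toLinearMap ∘ₗ B.toLinearMap).range
      rw [LinearMap.range_comp]
      infer_instance)
    (by
      intro A B hA
      have hA' : FiniteDimensional ℂ A.toLinearMap.range := hA
      exact Submodule.finiteDimensional_of_le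
        (LinearMap.range_comp_le_range B.toLinearMap A.toLinearMap))

theorem mem_finiteRankIdeal {A : H →L[ℂ] H} :
    A ∈ finiteRankIdeal H ↔ FiniteDimensional ℂ A.toLinearMap.range :=
  TwoSidedIdeal.mem_mk' _ _ _ _ _ _ A

variable {H}

/-- The inner derivation `X ↦ T X - X T` on the algebra of bounded operators on `H`. -/
def innerDerivation (T : H →L[ℂ] H) : (H →L[ℂ] H) →ₗ[ℂ] (H →L[ℂ] H) where
  toFun X := T * X - X * T
  map_add' X Y := by rw [mul_add, add_mul]; abel
  map_smul' c X := by
    rw [mul_smul_comm, smul_mul_assoc, ← smul_sub, RingHom.id_apply]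

end

section InnerDerivationRange

variable {H : Type*} [NormedAddCommGroup H] [InnerProductSpace ℂ H]

/-! Already the rank-one operators cannot all lie in the range. Subtracting a boundary point of the
spectrum from `T` leaves the derivation unchanged and gives a singular limit `S` of invertibles, so
`S` and its adjoint have unit vectors `x n`, `y n` that they send to 0 at rate 1/(n+1). If every
rank-one operator were some `S X - X S`, pairing with these vectors would make (n+1)|⟨v, x n⟩||⟨y n,
u⟩| bounded for all `u`, `v`; uniform boundedness, used twice, refutes this. -/

theorem innerDerivation_sub_algebraMap (T : H →L[ℂ] H) (c : ℂ) :
    innerDerivation (T - algebraMap ℂ (H →L[ℂ] H) c) = innerDerivation T := by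
  ext1 X
  simp only [innerDerivation, LinearMap.coe_mk, AddHom.coe_mk, sub_mul, mul_sub,
    Algebra.commutes c X]
  abel

theorem rankOne_mem_finiteRankIdeal (u v : H) :
    InnerProductSpace.rankOne ℂ u v ∈ finiteRankIdeal H := by
  rw [mem_finiteRankIdeal]
  refine Submodule.finiteDimensional_of_le (S₂ := Submodule.span ℂ {u}) ?_
  rintro _ ⟨z, rfl⟩
  exact Submodule.mem_span_singleton.2 ⟨inner ℂ v z, rfl⟩

variable [CompleteSpace H]

/-- A non-invertible operator in the closure of the invertible ones is not bounded below. -/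
theorem exists_norm_eq_one_norm_apply_le_of_mem_closure_units {S : H →L[ℂ] H}
    (hS : ¬ IsUnit S) (hcl : S ∈ closure {R : H →L[ℂ] H | IsUnit R}) {ε : ℝ} (hε : 0 < ε) :
    ∃ x : H, ‖x‖ = 1 ∧ ‖S x‖ ≤ ε := by
  by_contra! hne
  have hbelow : ∀ x : H, ε * ‖x‖ ≤ ‖S x‖ := by
    intro x
    rcases eq_or_ne x 0 with rfl | hx
    · simp
    have hx0 : 0 < ‖x‖ := norm_pos_iff.2 hx
    have h := hne (((‖x‖⁻¹ : ℝ) : ℂ) • x) (by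
      rw [norm_smul, Complex.norm_real, norm_inv, norm_norm, inv_mul_cancel₀ hx0.ne'])
    rw [map_smul, norm_smul, Complex.norm_real, norm_inv, norm_norm, ← div_eq_inv_mul,
      lt_div_iff₀ hx0] at h
    exact h.le
  obtain ⟨R, ⟨u, rfl⟩, hR⟩ := Metric.mem_closure_iff.1 hcl (ε / 2) (half_pos hε)
  rw [dist_eq_norm] at hR
  -- Being within ε/2 of `S`, `u` is bounded below by ε/2. Hence `S` lies in the ball about `u` of
  -- radius `‖u⁻¹‖⁻¹`, which consists of units.
  have hinv : ‖(↑u⁻¹ : H →L[ℂ] H)‖ ≤ 2 / ε := by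
    refine ContinuousLinearMap.opNorm_le_bound _ (by positivity) fun z => ?_
    set x := (↑u⁻¹ : H →L[ℂ] H) z with hx
    have hz : (u : H →L[ℂ] H) x = z := by
      rw [hx, ← mul_apply_eq_comp, u.mul_inv, one_apply_eq_self]
    have h1 : ‖(S - u) x‖ ≤ ε / 2 * ‖x‖ := (S - u).le_of_opNorm_le hR.le x
    have h2 : ‖S x‖ ≤ ‖(S - u) x‖ + ‖z‖ := by
      have : S x = (S - u) x + z := by simp [hz]
      rw [this]
      exact norm_add_le _ _
    have h3 := hbelow x
    rw [div_mul_eq_mul_div, le_div_iff₀ hε]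
    linarith
  refine hS ?_
  nontriviality H →L[ℂ] H
  have hpos : 0 < ‖(↑u⁻¹ : H →L[ℂ] H)‖ := Units.norm_pos _
  have hlt : ‖S - u‖ < ‖(↑u⁻¹ : H →L[ℂ] H)‖⁻¹ := by
    refine hR.trans_le ?_
    rw [le_inv_comm₀ (half_pos hε) hpos, inv_div]
    exact hinv
  exact ⟨u.ofNearby S hlt, rfl⟩

/-- Some translate of a bounded operator is a non-invertible limit of invertible operators. -/
theorem exists_sub_algebraMap_mem_closure_units [Nontrivial H] (T : H →L[ℂ] H) :
    ∃ c : ℂ, ¬ IsUnit (T - algebraMap ℂ (H →L[ℂ] H) c) ∧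
      T - algebraMap ℂ (H →L[ℂ] H) c ∈ closure {R : H →L[ℂ] H | IsUnit R} := by
  have hfr : (frontier (spectrum ℂ T)).Nonempty := by
    refine nonempty_frontier_iff.2 ⟨spectrum.nonempty T, fun h => ?_⟩
    exact NormedSpace.unbounded_univ ℂ ℂ (h ▸ spectrum.isBounded T)
  obtain ⟨c, hc⟩ := hfr
  have hmem : ∀ z : ℂ, z ∈ spectrum ℂ T ↔ ¬ IsUnit (T - algebraMap ℂ (H →L[ℂ] H) z) := by
    intro z
    rw [spectrum.mem_iff, IsUnit.sub_iff]
  rw [frontier_eq_closure_inter_closure, (spectrum.isClosed T).closure_eq] at hc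
  refine ⟨c, (hmem c).1 hc.1, ?_⟩
  have hcont : Continuous fun z : ℂ => T - algebraMap ℂ (H →L[ℂ] H) z :=
    continuous_const.sub (continuous_algebraMap ℂ _)
  refine map_mem_closure (f := fun z : ℂ => T - algebraMap ℂ (H →L[ℂ] H) z) hcont hc.2 fun z hz => ?_
  exact not_not.1 fun h => hz ((hmem z).2 h)

/-- If `S` and its adjoint both fail to be bounded below, then some rank-one operator is not of
the form `S X - X S`. -/
theorem exists_rankOne_notMem_range_innerDerivation {S : H →L[ℂ] H}
    (hS : ∀ ε : ℝ, 0 < ε → ∃ x : H, ‖x‖ = 1 ∧ ‖S x‖ ≤ ε)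
    (hS' : ∀ ε : ℝ, 0 < ε → ∃ y : H, ‖y‖ = 1 ∧ ‖ContinuousLinearMap.adjoint S y‖ ≤ ε) :
    ∃ u v : H, InnerProductSpace.rankOne ℂ u v ∉ Set.range (innerDerivation S) := by
  by_contra! hall
  have hpos : ∀ n : ℕ, (0 : ℝ) < 1 / ((n : ℝ) + 1) := fun n => by positivity
  have hnorm : ∀ n : ℕ, ‖(n : ℂ) + 1‖ = (n : ℝ) + 1 := fun n => by
    exact_mod_cast Complex.norm_natCast (n + 1)
  choose x hx hSx using fun n : ℕ => hS _ (hpos n)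
  choose y hy hSy using fun n : ℕ => hS' _ (hpos n)
  have hbound : ∀ u v : H, ∃ C : ℝ, ∀ n : ℕ,
      ((n : ℝ) + 1) * (‖inner ℂ v (x n)‖ * ‖inner ℂ (y n) u‖) ≤ C := by
    intro u v
    obtain ⟨X, hX⟩ := hall u v
    refine ⟨2 * ‖X‖, fun n => ?_⟩
    -- Each term on the right has `S` or its adjoint acting on an approximate null vector.
    have happ : inner ℂ v (x n) * inner ℂ (y n) u =
        inner ℂ (ContinuousLinearMap.adjoint S (y n)) (X (x n)) -
          inner ℂ (y n) (X (S (x n))) := by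
      have h := congrArg (fun A : H →L[ℂ] H => inner ℂ (y n) (A (x n))) hX
      simp only [innerDerivation, LinearMap.coe_mk, AddHom.coe_mk, sub_apply,
        mul_apply_eq_comp, InnerProductSpace.rankOne_apply, inner_sub_right,
        inner_smul_right] at h
      rw [← h, ContinuousLinearMap.adjoint_inner_left]
    have h1 : ‖inner ℂ (ContinuousLinearMap.adjoint S (y n)) (X (x n))‖ ≤
        1 / ((n : ℝ) + 1) * ‖X‖ := by
      refine (norm_inner_le_norm _ _).trans ?_
      have := X.le_opNorm (x n)
      rw [hx, mul_one] at this
      exact mul_le_mul (hSy n) this (norm_nonneg _) (hpos n).le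
    have h2 : ‖inner ℂ (y n) (X (S (x n)))‖ ≤ ‖X‖ * (1 / ((n : ℝ) + 1)) := by
      refine (norm_inner_le_norm _ _).trans ?_
      rw [hy, one_mul]
      exact X.le_opNorm_of_le (hSx n)
    rw [← norm_mul, happ, ← le_div_iff₀' (by positivity)]
    refine (norm_sub_le _ _).trans ((add_le_add h1 h2).trans_eq ?_)
    ring
  -- Uniform boundedness in `u` for fixed `v`; `‖y n‖ = 1` eliminates `y n`.
  have hweak : ∀ v : H, ∃ C : ℝ, ∀ n : ℕ, ((n : ℝ) + 1) * ‖inner ℂ v (x n)‖ ≤ C := by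
    intro v
    obtain ⟨C, hC⟩ := banach_steinhaus
      (g := fun n : ℕ => (((n : ℂ) + 1) * inner ℂ v (x n)) • innerSL ℂ (y n)) fun u => by
        obtain ⟨C, hC⟩ := hbound u v
        refine ⟨C, fun n => ?_⟩
        rw [smul_apply, innerSL_apply_apply, norm_smul, norm_mul, mul_assoc]
        rw [hnorm]
        exact hC n
    refine ⟨C, fun n => ?_⟩
    have h := hC n
    rw [norm_smul, innerSL_apply_norm, hy, mul_one, norm_mul] at h
    rwa [hnorm] at h
  -- Now in `v`: these functionals have norm n+1, so they cannot be uniformly bounded.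
  obtain ⟨C, hC⟩ := banach_steinhaus
    (g := fun n : ℕ => ((n : ℂ) + 1) • innerSL ℂ (x n)) fun v => by
      obtain ⟨C, hC⟩ := hweak v
      refine ⟨C, fun n => ?_⟩
      rw [smul_apply, innerSL_apply_apply, norm_smul, norm_inner_symm]
      rw [hnorm]
      exact hC n
  obtain ⟨n, hn⟩ := exists_nat_gt C
  have h := hC n
  rw [norm_smul, innerSL_apply_norm, hx, mul_one, hnorm] at h
  linarith

/-- The range of an inner derivation does not contain all finite-rank operators. -/
theorem not_finiteRankIdeal_subset_range_innerDerivation [Nontrivial H] (T : H →L[ℂ] H) :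
    ¬ (finiteRankIdeal H : Set (H →L[ℂ] H)) ⊆ Set.range (innerDerivation T) := by
  intro hsub
  obtain ⟨c, hc, hcl⟩ := exists_sub_algebraMap_mem_closure_units T
  set S := T - algebraMap ℂ (H →L[ℂ] H) c with hS
  have hc' : ¬ IsUnit (star S) := fun h => hc (isUnit_star.1 h)
  have hcl' : star S ∈ closure {R : H →L[ℂ] H | IsUnit R} :=
    map_mem_closure continuous_star hcl fun R hR => IsUnit.star hR
  obtain ⟨u, v, huv⟩ := exists_rankOne_notMem_range_innerDerivation (S := S)
    (fun _ => exists_norm_eq_one_norm_apply_le_of_mem_closure_units hc hcl)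
    (fun _ => exists_norm_eq_one_norm_apply_le_of_mem_closure_units hc' hcl')
  rw [hS, innerDerivation_sub_algebraMap] at huv
  exact huv (hsub (rankOne_mem_finiteRankIdeal u v))

end InnerDerivationRange

theorem corollary3p2 {H : Type*} [NormedAddCommGroup H] [InnerProductSpace ℂ H]
    [CompleteSpace H] [TopologicalSpace.SeparableSpace H]
    (hH : ¬ FiniteDimensional ℂ H) (T : H →L[ℂ] H)
    (J : TwoSidedIdeal (H →L[ℂ] H)) (hJ : finiteRankIdeal H < J) :
    ¬ (J : Set (H →L[ℂ] H)) ⊆ Set.range (innerDerivation T) := by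
  have : Nontrivial H := by
    by_contra h
    rw [not_nontrivial_iff_subsingleton] at h
    exact hH inferInstance
  intro hsub
  exact not_finiteRankIdeal_subset_range_innerDerivation T fun A hA => hsub (hJ.le hA)
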